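/- Let $A \in \mathbb{R}^{n \times d}$ and $b \in \mathbb{R}^n$ be such that the solution set $\mathcal{H} = \{x \in \mathbb{R}^d : Ax = b\}$ is nonempty, let $\mathcal{P}_{\mathcal{H}}$ denote the orthogonal projection onto $\mathcal{H}$, and let $x_0 \in \mathbb{R}^d$. Let $w_0, w_1, \ldots$ be independent standard normal random vectors in $\mathbb{R}^n$, and let $\{x_k\}$ be generated by Gaussian Vector Kaczmarz, \[ x_{k+1} = x_k - A^\intercal w_k \, \frac{w_k^\intercal (A x_k - b)}{\|A^\intercal w_k\|_2^2}, \qquad k = 0, 1, 2, \ldots, \] where $x_{k+1} = x_k$ if $A^\intercal w_k = 0$. Stopping times are understood with respect to the filtration $\mathcal{F}_k = \sigma(x_0, w_0, x_1, \ldots, w_{k-1}, x_k)$, $k \ge 0$, and take values in $\{0, 1, 2, \ldots\} \cup \{\infty\}$. Then at least one of the following holds. \begin{enumerate} \item There exists a stopping time $\tau$ with $\mathbb{E}[\tau] < \infty$ such that $x_\tau \in \mathcal{H}$ almost surely. \item There exist stopping times $\tau_0, \tau_1, \tau_2, \ldots$ with $\mathbb{E}[\tau_j] \leq j \, \mathrm{rank}(A)$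 for all $j \geq 0$, and there exists $\bar\gamma \in (0,1)$ such that, for every $\gamma \in (\bar\gamma, 1)$, \[ \mathbb{P}\left[ \bigcup_{L=0}^\infty \bigcap_{j=L}^\infty \left\{ \|x_{\tau_j} - \mathcal{P}_{\mathcal{H}} x_0\|_2^2 \leq \gamma^j \|x_0 - \mathcal{P}_{\mathcal{H}} x_0\|_2^2 \right\} \right] = 1. \] \end{enumerate} -/

import Mathlib

open MeasureTheory ProbabilityTheory Filter
open scoped ENNReal

noncomputable section

namespace Kaczmarz

/-- The solution set `H = {x : A x = b}` of the linear system, as an affine subspace of `ℝ^d`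
(possibly empty). -/
def solutionSpace {n d : ℕ} (A : Matrix (Fin n) (Fin d) ℝ) (b : EuclideanSpace ℝ (Fin n)) :
    AffineSubspace ℝ (EuclideanSpace ℝ (Fin d)) where
  carrier := {x | A.toEuclideanLin x = b}
  smul_vsub_vadd_mem' := by
    intro c p₁ p₂ p₃ h₁ h₂ h₃
    simp only [Set.mem_ofPred_eq] at h₁ h₂ h₃ ⊢
    simp only [vsub_eq_sub, vadd_eq_add, map_add, map_smul, map_sub, h₁, h₂, h₃, sub_self,
      smul_zero, zero_add]

/-- One Kaczmarz update with sketch vector `w`: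
`x - Aᵀw · wᵀ(Ax - b) / ‖Aᵀw‖²`. When `Aᵀw = 0` the quotient is `0` and `x` is unchanged, in
agreement with the pseudo-inverse convention `0† = 0`. -/
def step {n d : ℕ} (A : Matrix (Fin n) (Fin d) ℝ) (b : EuclideanSpace ℝ (Fin n))
    (x : EuclideanSpace ℝ (Fin d)) (w : EuclideanSpace ℝ (Fin n)) : EuclideanSpace ℝ (Fin d) :=
  x - (inner ℝ w (A.toEuclideanLin x - b) / ‖A.transpose.toEuclideanLin w‖ ^ 2) •
    A.transpose.toEuclideanLin w

/-- The iterates `x_0, x_1, …` driven by the sketch vectors `w_0, w_1, …`. -/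
def iterate {n d : ℕ} {Ω : Type*} (A : Matrix (Fin n) (Fin d) ℝ)
    (b : EuclideanSpace ℝ (Fin n)) (x₀ : EuclideanSpace ℝ (Fin d))
    (w : ℕ → Ω → EuclideanSpace ℝ (Fin n)) : ℕ → Ω → EuclideanSpace ℝ (Fin d)
  | 0 => fun _ => x₀
  | k + 1 => fun ω => step A b (iterate A b x₀ w k ω) (w k ω)

lemma measurable_iterate {n d : ℕ} {Ω : Type*} [MeasurableSpace Ω]
    (A : Matrix (Fin n) (Fin d) ℝ) (b : EuclideanSpace ℝ (Fin n))
    (x₀ : EuclideanSpace ℝ (Fin d)) {w : ℕ → Ω → EuclideanSpace ℝ (Fin n)}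
    (hw : ∀ k, Measurable (w k)) (k : ℕ) : Measurable (iterate A b x₀ w k) := by
  induction k with
  | zero => exact measurable_const
  | succ k ih =>
    have hA : Measurable fun ω => A.toEuclideanLin (iterate A b x₀ w k ω) :=
      (LinearMap.continuous_of_finiteDimensional A.toEuclideanLin).measurable.comp ih
    have hT : Measurable fun ω => A.transpose.toEuclideanLin (w k ω) :=
      (LinearMap.continuous_of_finiteDimensional A.transpose.toEuclideanLin).measurable.comp (hw k)
    exact ih.sub ((((hw k).inner (hA.sub_const b)).div (hT.norm.pow_const 2)).smul hT)

/-- The information available before the `k`-th sketch is drawn: the σ-algebra generated by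
`x_0, w_0, x_1, …, w_{k-1}, x_k`. -/
def history {n d : ℕ} {Ω : Type*} [mΩ : MeasurableSpace Ω]
    (A : Matrix (Fin n) (Fin d) ℝ) (b : EuclideanSpace ℝ (Fin n))
    (x₀ : EuclideanSpace ℝ (Fin d)) (w : ℕ → Ω → EuclideanSpace ℝ (Fin n))
    (hw : ∀ k, Measurable (w k)) : Filtration ℕ mΩ where
  seq k := (⨆ j < k, MeasurableSpace.comap (w j) inferInstance) ⊔
    ⨆ j ≤ k, MeasurableSpace.comap (iterate A b x₀ w j) inferInstance
  mono' := fun _ _ h => sup_le_sup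
    (biSup_mono fun _ hj => lt_of_lt_of_le hj h) (biSup_mono fun _ hj => le_trans hj h)
  le' := fun _ => sup_le (iSup₂_le fun j _ => (hw j).comap_le)
    (iSup₂_le fun j _ => (measurable_iterate A b x₀ hw j).comap_le)

end Kaczmarz

end

namespace Kaczmarz

open Set

variable {n d : ℕ} (A : Matrix (Fin n) (Fin d) ℝ) (b : EuclideanSpace ℝ (Fin n))

/-! Deterministic stopping times suffice. If `x₀` solves the system, `τ = 0` gives the first
alternative. Otherwise the second holds with `τ_j = j * rank A`. Let `p` be the projection of `x₀`.
Each update projects the error `x_k - p` off the direction `Aᵀw`, and the error stays in `(ker A)ᗮ`.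
There the mean relative decrease is at least some `c > 0`, by compactness of the unit sphere
(`exists_integral_gain_ge`). As `w_k` is independent of `x_k`, the mean squared error is at most `(1
- c) ^ k * ‖x₀ - p‖ ^ 2`. Markov and Borel–Cantelli make this an almost sure bound at any rate `γ >
1 - c`. -/

lemma inner_toEuclideanLin_right (w : EuclideanSpace ℝ (Fin n)) (e : EuclideanSpace ℝ (Fin d)) :
    inner ℝ w (A.toEuclideanLin e) = inner ℝ (A.transpose.toEuclideanLin w) e := by
  rw [← Matrix.conjTranspose_eq_transpose_of_trivial, Matrix.toEuclideanLin_conjTranspose_eq_adjoint,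
    LinearMap.adjoint_inner_left]

lemma measurable_toEuclideanLin {m l : ℕ} (B : Matrix (Fin m) (Fin l) ℝ) :
    Measurable fun x => B.toEuclideanLin x :=
  (LinearMap.continuous_of_finiteDimensional B.toEuclideanLin).measurable

lemma measurable_step : Measurable fun q : EuclideanSpace ℝ (Fin d) × EuclideanSpace ℝ (Fin n) =>
    step A b q.1 q.2 := by
  have hA : Measurable fun q : EuclideanSpace ℝ (Fin d) × EuclideanSpace ℝ (Fin n) =>
      A.toEuclideanLin q.1 := (measurable_toEuclideanLin A).comp measurable_fst
  have hT : Measurable fun q : EuclideanSpace ℝ (Fin d) × EuclideanSpace ℝ (Fin n) =>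
      A.transpose.toEuclideanLin q.2 := (measurable_toEuclideanLin A.transpose).comp measurable_snd
  exact measurable_fst.sub
    (((measurable_snd.inner (hA.sub_const b)).div (hT.norm.pow_const 2)).smul hT)

/-- The decrease of the squared error `‖e‖²` in one Kaczmarz update with sketch vector `w`. -/
noncomputable def gain (e : EuclideanSpace ℝ (Fin d)) (w : EuclideanSpace ℝ (Fin n)) : ℝ :=
  inner ℝ (A.transpose.toEuclideanLin w) e ^ 2 / ‖A.transpose.toEuclideanLin w‖ ^ 2

lemma gain_nonneg (e : EuclideanSpace ℝ (Fin d)) (w : EuclideanSpace ℝ (Fin n)) :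
    0 ≤ gain A e w := by
  unfold gain; positivity

lemma gain_le (e : EuclideanSpace ℝ (Fin d)) (w : EuclideanSpace ℝ (Fin n)) :
    gain A e w ≤ ‖e‖ ^ 2 := by
  unfold gain
  refine div_le_of_le_mul₀ (by positivity) (by positivity) ?_
  rw [← mul_pow, mul_comm]
  exact sq_le_sq.2 (by simpa [abs_mul] using abs_real_inner_le_norm _ e)

lemma gain_smul (c : ℝ) (e : EuclideanSpace ℝ (Fin d)) (w : EuclideanSpace ℝ (Fin n)) :
    gain A (c • e) w = c ^ 2 * gain A e w := by
  simp only [gain, inner_smul_right]; ring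

lemma measurable_gain (e : EuclideanSpace ℝ (Fin d)) : Measurable (gain A e) := by
  have hT := measurable_toEuclideanLin A.transpose
  exact ((hT.inner_const).pow_const 2).div (hT.norm.pow_const 2)

lemma continuous_gain (w : EuclideanSpace ℝ (Fin n)) : Continuous fun e => gain A e w := by
  unfold gain; fun_prop

/-- Pythagoras: since `A p = b`, the update subtracts from `x - p` its component along `Aᵀw`. If
`Aᵀw = 0`, division by zero makes the gain vanish. -/
lemma norm_step_sub_sq {p : EuclideanSpace ℝ (Fin d)} (hp : A.toEuclideanLin p = b)
    (x : EuclideanSpace ℝ (Fin d)) (w : EuclideanSpace ℝ (Fin n)) :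
    ‖step A b x w - p‖ ^ 2 = ‖x - p‖ ^ 2 - gain A (x - p) w := by
  have h : step A b x w - p = (x - p) -
      (inner ℝ (A.transpose.toEuclideanLin w) (x - p) / ‖A.transpose.toEuclideanLin w‖ ^ 2) •
        A.transpose.toEuclideanLin w := by
    rw [step, ← hp, ← map_sub, inner_toEuclideanLin_right]; abel
  rw [h, norm_sub_sq_real, gain, inner_smul_right, norm_smul, real_inner_comm, mul_pow,
    Real.norm_eq_abs, sq_abs]
  rcases eq_or_ne ‖A.transpose.toEuclideanLin w‖ 0 with h0 | h0
  · simp [h0]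
  · field_simp; ring

/-- Updates move along the row space. This keeps the error away from `ker A`, where the gain is
zero. -/
lemma step_sub_mem {x p : EuclideanSpace ℝ (Fin d)} (w : EuclideanSpace ℝ (Fin n))
    (hx : x - p ∈ (LinearMap.ker A.toEuclideanLin)ᗮ) :
    step A b x w - p ∈ (LinearMap.ker A.toEuclideanLin)ᗮ := by
  have hT : A.transpose.toEuclideanLin w ∈ (LinearMap.ker A.toEuclideanLin)ᗮ := by
    rw [Submodule.mem_orthogonal']
    intro u hu
    rw [← inner_toEuclideanLin_right, LinearMap.mem_ker.1 hu, inner_zero_right]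
  rw [step, sub_right_comm]
  exact sub_mem hx (Submodule.smul_mem _ _ hT)

lemma integrable_gain (e : EuclideanSpace ℝ (Fin d)) :
    Integrable (gain A e) (stdGaussian (EuclideanSpace ℝ (Fin n))) :=
  Integrable.of_bound (measurable_gain A e).aestronglyMeasurable (‖e‖ ^ 2) <|
    Eventually.of_forall fun w => by
      rw [Real.norm_of_nonneg (gain_nonneg A e w)]; exact gain_le A e w

lemma continuous_integral_gain :
    Continuous fun e => ∫ w, gain A e w ∂stdGaussian (EuclideanSpace ℝ (Fin n)) := by
  refine continuous_iff_continuousAt.2 fun e => ?_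
  refine continuousAt_of_dominated (bound := fun _ => (‖e‖ + 1) ^ 2)
    (Eventually.of_forall fun e => (measurable_gain A e).aestronglyMeasurable) ?_
    (integrable_const _) (Eventually.of_forall fun w => (continuous_gain A w).continuousAt)
  filter_upwards [Metric.ball_mem_nhds e one_pos] with f hf
  refine Eventually.of_forall fun w => ?_
  rw [Real.norm_of_nonneg (gain_nonneg A f w)]
  refine (gain_le A f w).trans (pow_le_pow_left₀ (norm_nonneg _) ?_ 2)
  have h1 : ‖f - e‖ < 1 := by rwa [← dist_eq_norm]
  linarith [norm_sub_norm_le f e]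

/-- A vector almost surely orthogonal to a standard Gaussian vector vanishes. -/
lemma eq_zero_of_ae_inner_stdGaussian_eq_zero {g : EuclideanSpace ℝ (Fin n)}
    (h : ∀ᵐ w ∂stdGaussian (EuclideanSpace ℝ (Fin n)), inner ℝ w g = 0) : g = 0 := by
  -- The variance of `⟪g, w⟫` is `‖g‖ ^ 2`.
  have hv := variance_dual_stdGaussian (innerSL ℝ g)
  have h0 : Var[innerSL ℝ g; stdGaussian (EuclideanSpace ℝ (Fin n))] = 0 := by
    rw [variance_congr (Y := fun _ => (0 : ℝ))]
    · exact variance_zero _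
    · filter_upwards [h] with w hw
      rw [innerSL_apply_apply, real_inner_comm, hw]
  rw [h0] at hv
  simpa using hv.symm

/-- Zero mean gain forces `⟪w, A e⟫ = 0` almost surely, so `A e = 0` and `e` lies in `ker A ∩ (ker
A)ᗮ`. -/
lemma integral_gain_pos {e : EuclideanSpace ℝ (Fin d)}
    (he : e ∈ (LinearMap.ker A.toEuclideanLin)ᗮ) (he0 : e ≠ 0) :
    0 < ∫ w, gain A e w ∂stdGaussian (EuclideanSpace ℝ (Fin n)) := by
  refine lt_of_le_of_ne (integral_nonneg (gain_nonneg A e)) fun h => he0 ?_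
  have h1 := (integral_eq_zero_iff_of_nonneg (gain_nonneg A e) (integrable_gain A e)).1 h.symm
  have h2 : A.toEuclideanLin e = 0 := by
    refine eq_zero_of_ae_inner_stdGaussian_eq_zero ?_
    filter_upwards [h1] with w hw
    rw [inner_toEuclideanLin_right]
    rcases div_eq_zero_iff.1 hw with h | h
    · exact pow_eq_zero_iff two_ne_zero |>.1 h
    · rw [norm_eq_zero.1 (pow_eq_zero_iff two_ne_zero |>.1 h), inner_zero_left]
  exact inner_self_eq_zero.1 ((Submodule.mem_orthogonal _ _).1 he e (LinearMap.mem_ker.2 h2))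

lemma exists_integral_gain_ge : ∃ c ∈ Ioo (0 : ℝ) 1,
    ∀ e ∈ (LinearMap.ker A.toEuclideanLin)ᗮ,
      c * ‖e‖ ^ 2 ≤ ∫ w, gain A e w ∂stdGaussian (EuclideanSpace ℝ (Fin n)) := by
  obtain ⟨a, ha, hK⟩ := ((isCompact_sphere (0 : EuclideanSpace ℝ (Fin d)) 1).inter_right
    (Submodule.closed_of_finiteDimensional
      (LinearMap.ker A.toEuclideanLin)ᗮ)).exists_forall_le'
    (continuous_integral_gain A).continuousOn (a := 0) fun e he =>
      integral_gain_pos A he.2 (ne_zero_of_mem_unit_sphere ⟨e, he.1⟩)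
  -- The cap `1 / 2` keeps `1 - c` strictly positive; general `e` then follows by homogeneity of
  -- degree two.
  refine ⟨min a (1 / 2), ⟨by positivity, (min_le_right _ _).trans_lt (by norm_num)⟩,
    fun e he => ?_⟩
  rcases eq_or_ne e 0 with rfl | he0
  · simpa using integral_nonneg (gain_nonneg A _)
  have hn : ‖e‖ ≠ 0 := norm_ne_zero_iff.2 he0
  have h := hK (‖e‖⁻¹ • e) ⟨by simp [norm_smul, hn], Submodule.smul_mem _ _ he⟩
  simp only [gain_smul, integral_const_mul] at h
  calc min a (1 / 2) * ‖e‖ ^ 2 ≤ a * ‖e‖ ^ 2 := by gcongr; exact min_le_left _ _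
    _ ≤ (‖e‖⁻¹ ^ 2 * ∫ w, gain A e w ∂stdGaussian (EuclideanSpace ℝ (Fin n))) * ‖e‖ ^ 2 := by
      gcongr
    _ = _ := by field_simp

lemma lintegral_norm_step_sub_sq_le {c : ℝ}
    (hc : ∀ e ∈ (LinearMap.ker A.toEuclideanLin)ᗮ,
      c * ‖e‖ ^ 2 ≤ ∫ w, gain A e w ∂stdGaussian (EuclideanSpace ℝ (Fin n)))
    {p : EuclideanSpace ℝ (Fin d)} (hp : A.toEuclideanLin p = b)
    {x : EuclideanSpace ℝ (Fin d)} (hx : x - p ∈ (LinearMap.ker A.toEuclideanLin)ᗮ) :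
    ∫⁻ w, ENNReal.ofReal (‖step A b x w - p‖ ^ 2) ∂stdGaussian (EuclideanSpace ℝ (Fin n))
      ≤ ENNReal.ofReal ((1 - c) * ‖x - p‖ ^ 2) := by
  simp only [norm_step_sub_sq A b hp]
  have hint : Integrable (fun w => ‖x - p‖ ^ 2 - gain A (x - p) w)
      (stdGaussian (EuclideanSpace ℝ (Fin n))) := (integrable_const _).sub (integrable_gain A _)
  rw [← ofReal_integral_eq_lintegral_ofReal hint
    (Eventually.of_forall fun w => sub_nonneg.2 (gain_le A _ w)),
    integral_sub (integrable_const _) (integrable_gain A _)]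
  refine ENNReal.ofReal_le_ofReal ?_
  simp only [integral_const, probReal_univ, one_smul]
  linarith [hc _ hx]

/-! ### Mean contraction along the random iterates -/

section Random

variable {Ω : Type*} (x₀ : EuclideanSpace ℝ (Fin d)) (w : ℕ → Ω → EuclideanSpace ℝ (Fin n))

lemma iterate_sub_mem {p : EuclideanSpace ℝ (Fin d)}
    (h₀ : x₀ - p ∈ (LinearMap.ker A.toEuclideanLin)ᗮ) (k : ℕ) (ω : Ω) :
    iterate A b x₀ w k ω - p ∈ (LinearMap.ker A.toEuclideanLin)ᗮ := by
  induction k with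
  | zero => exact h₀
  | succ k ih => exact step_sub_mem A b _ ih

/-- `x_k` uses only the sketches before `w_k`, hence its independence from `w_k`. -/
lemma measurable_iterate_past (k : ℕ) :
    Measurable[⨆ j ∈ Iio k, MeasurableSpace.comap (w j) inferInstance] (iterate A b x₀ w k) := by
  induction k with
  | zero => exact measurable_const
  | succ k ih =>
    refine (measurable_step A b).comp (Measurable.prodMk (ih.mono ?_ le_rfl) ?_)
    · exact biSup_mono fun j hj => lt_trans hj (Nat.lt_succ_self k)
    · refine (comap_measurable (w k)).mono ?_ le_rfl
      exact le_biSup (fun j => MeasurableSpace.comap (w j) inferInstance) (Nat.lt_succ_self k)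

variable [MeasurableSpace Ω] {P : Measure Ω} {w}

lemma indepFun_iterate (hw : ∀ k, Measurable (w k)) (hindep : iIndepFun w P) (k : ℕ) :
    IndepFun (iterate A b x₀ w k) (w k) P := by
  have h := indep_iSup_of_disjoint (fun i => (hw i).comap_le) hindep.iIndep
    (S := Iio k) (T := {k}) (by simp)
  rw [IndepFun_iff_Indep]
  refine indep_of_indep_of_le_left (indep_of_indep_of_le_right h ?_)
    (measurable_iterate_past A b x₀ w k).comap_le
  exact le_biSup (fun j => MeasurableSpace.comap (w j) inferInstance) (mem_singleton k)

lemma lintegral_norm_iterate_sub_sq_le [IsProbabilityMeasure P] (hw : ∀ k, Measurable (w k))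
    (hlaw : ∀ k, HasLaw (w k) (stdGaussian (EuclideanSpace ℝ (Fin n))) P)
    (hindep : iIndepFun w P) {c : ℝ} (hc1 : c ≤ 1)
    (hc : ∀ e ∈ (LinearMap.ker A.toEuclideanLin)ᗮ,
      c * ‖e‖ ^ 2 ≤ ∫ w, gain A e w ∂stdGaussian (EuclideanSpace ℝ (Fin n)))
    {p : EuclideanSpace ℝ (Fin d)} (hp : A.toEuclideanLin p = b)
    (h₀ : x₀ - p ∈ (LinearMap.ker A.toEuclideanLin)ᗮ) (k : ℕ) :
    ∫⁻ ω, ENNReal.ofReal (‖iterate A b x₀ w k ω - p‖ ^ 2) ∂P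
      ≤ ENNReal.ofReal ((1 - c) ^ k * ‖x₀ - p‖ ^ 2) := by
  have hc0 : 0 ≤ 1 - c := sub_nonneg.2 hc1
  induction k with
  | zero => simp [iterate]
  | succ k ih =>
    have hx := measurable_iterate A b x₀ hw k
    have hmeas : Measurable fun q : EuclideanSpace ℝ (Fin d) × EuclideanSpace ℝ (Fin n) =>
        ENNReal.ofReal (‖step A b q.1 q.2 - p‖ ^ 2) :=
      (((measurable_step A b).sub_const p).norm.pow_const 2).ennreal_ofReal
    -- Independence makes the joint law a product, so Tonelli allows averaging over `w_k` with `x_k`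
    -- frozen.
    have hjoint := (indepFun_iff_map_prod_eq_prod_map_map hx.aemeasurable
      (hw k).aemeasurable).1 (indepFun_iterate A b x₀ hw hindep k)
    calc ∫⁻ ω, ENNReal.ofReal (‖iterate A b x₀ w (k + 1) ω - p‖ ^ 2) ∂P
        = ∫⁻ q, ENNReal.ofReal (‖step A b q.1 q.2 - p‖ ^ 2)
            ∂(P.map fun ω => (iterate A b x₀ w k ω, w k ω)) :=
          (lintegral_map hmeas (hx.prodMk (hw k))).symm
      _ = ∫⁻ ω, ∫⁻ v, ENNReal.ofReal (‖step A b (iterate A b x₀ w k ω) v - p‖ ^ 2)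
            ∂stdGaussian (EuclideanSpace ℝ (Fin n)) ∂P := by
          rw [hjoint, (hlaw k).map_eq, lintegral_prod _ hmeas.aemeasurable,
            lintegral_map hmeas.lintegral_prod_right' hx]
      _ ≤ ∫⁻ ω, ENNReal.ofReal (1 - c) *
            ENNReal.ofReal (‖iterate A b x₀ w k ω - p‖ ^ 2) ∂P := by
          refine lintegral_mono fun ω => ?_
          rw [← ENNReal.ofReal_mul hc0]
          exact lintegral_norm_step_sub_sq_le A b hc hp (iterate_sub_mem A b x₀ w h₀ k ω)
      _ = ENNReal.ofReal (1 - c) *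
            ∫⁻ ω, ENNReal.ofReal (‖iterate A b x₀ w k ω - p‖ ^ 2) ∂P :=
          lintegral_const_mul' _ _ ENNReal.ofReal_ne_top
      _ ≤ ENNReal.ofReal (1 - c) * ENNReal.ofReal ((1 - c) ^ k * ‖x₀ - p‖ ^ 2) := by gcongr
      _ = ENNReal.ofReal ((1 - c) ^ (k + 1) * ‖x₀ - p‖ ^ 2) := by
          rw [← ENNReal.ofReal_mul hc0, pow_succ']; ring_nf

end Random

/-- Random variables whose means decay geometrically at rate `ρ` are almost surely eventually
dominated by every slower geometric sequence. -/
lemma ae_eventually_le_of_lintegral_le {Ω : Type*} [MeasurableSpace Ω] {P : Measure Ω}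
    {f : ℕ → Ω → ℝ} (hf : ∀ j, Measurable (f j)) {ρ γ R : ℝ} (hρ : 0 ≤ ρ) (hργ : ρ < γ)
    (hR : 0 < R) (h : ∀ j, ∫⁻ ω, ENNReal.ofReal (f j ω) ∂P ≤ ENNReal.ofReal (ρ ^ j * R)) :
    ∀ᵐ ω ∂P, ∀ᶠ j in atTop, f j ω ≤ γ ^ j * R := by
  have hγ : 0 < γ := hρ.trans_lt hργ
  have hb : ∀ j, P {ω | ENNReal.ofReal (γ ^ j * R) ≤ ENNReal.ofReal (f j ω)}
      ≤ ENNReal.ofReal ((ρ / γ) ^ j) := fun j => by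
    have hpos : 0 < γ ^ j * R := by positivity
    -- Markov's inequality at level `γ ^ j * R`; the resulting bounds `(ρ / γ) ^ j` are summable.
    refine (meas_ge_le_lintegral_div (hf j).ennreal_ofReal.aemeasurable
      (ENNReal.ofReal_pos.2 hpos).ne' ENNReal.ofReal_ne_top).trans ?_
    refine (ENNReal.div_le_div_right (h j) _).trans ?_
    rw [← ENNReal.ofReal_div_of_pos hpos, mul_div_mul_right _ _ hR.ne', div_pow]
  have hsum : Summable fun j : ℕ => (ρ / γ) ^ j :=
    summable_geometric_of_lt_one (by positivity) ((div_lt_one hγ).2 hργ)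
  filter_upwards [ae_eventually_notMem
    ((ENNReal.tsum_le_tsum hb).trans_lt hsum.tsum_ofReal_lt_top).ne] with ω hω
  filter_upwards [hω] with j hj
  by_contra! hlt
  exact hj (ENNReal.ofReal_le_ofReal hlt.le)

lemma direction_solutionSpace [Nonempty (solutionSpace A b)] :
    (solutionSpace A b).direction = LinearMap.ker A.toEuclideanLin := by
  obtain ⟨p, hp⟩ := ‹Nonempty (solutionSpace A b)›
  ext v
  rw [← AffineSubspace.vadd_mem_iff_mem_direction v hp, LinearMap.mem_ker]
  change A.toEuclideanLin (v + p) = b ↔ _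
  rw [map_add, show A.toEuclideanLin p = b from hp, add_eq_right]

/-- In rank zero `A = 0`, and a consistent system is then solved by every vector. -/
lemma one_le_rank_of_notMem_solutionSpace [Nonempty (solutionSpace A b)]
    {x : EuclideanSpace ℝ (Fin d)} (hx : x ∉ solutionSpace A b) : 1 ≤ A.rank := by
  obtain ⟨p, hp⟩ := ‹Nonempty (solutionSpace A b)›
  by_contra! h
  have hA : A = 0 := by
    have hrange := Submodule.finrank_eq_zero.1 (Nat.lt_one_iff.1 h)
    refine Matrix.mulVec_injective (funext fun v => ?_)
    rw [← Matrix.mulVecLin_apply, LinearMap.range_eq_bot.1 hrange, LinearMap.zero_apply,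
      Matrix.zero_mulVec]
  refine hx ?_
  change A.toEuclideanLin p = b at hp
  change A.toEuclideanLin x = b
  rw [← hp, hA, map_zero, LinearMap.zero_apply, LinearMap.zero_apply]

end Kaczmarz

theorem mainTheorem9 {n d : ℕ} (A : Matrix (Fin n) (Fin d) ℝ) (b : EuclideanSpace ℝ (Fin n))
    [Nonempty (Kaczmarz.solutionSpace A b)] (x₀ : EuclideanSpace ℝ (Fin d))
    {Ω : Type*} [MeasurableSpace Ω] (P : Measure Ω) [IsProbabilityMeasure P]
    (w : ℕ → Ω → EuclideanSpace ℝ (Fin n)) (hw : ∀ k, Measurable (w k))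
    (hlaw : ∀ k, HasLaw (w k) (stdGaussian (EuclideanSpace ℝ (Fin n))) P)
    (hindep : iIndepFun w P) :
    (∃ τ : Ω → ℕ∞, IsStoppingTime (Kaczmarz.history A b x₀ w hw) τ ∧
      (∫⁻ ω, (τ ω : ℝ≥0∞) ∂P) < ∞ ∧
      ∀ᵐ ω ∂P, stoppedValue (Kaczmarz.iterate A b x₀ w) τ ω ∈ Kaczmarz.solutionSpace A b) ∨
    (∃ τ : ℕ → Ω → ℕ∞, (∀ j, IsStoppingTime (Kaczmarz.history A b x₀ w hw) (τ j)) ∧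
      (∀ j, (∫⁻ ω, (τ j ω : ℝ≥0∞) ∂P) ≤ (j : ℝ≥0∞) * (A.rank : ℝ≥0∞)) ∧
      ∃ γbar ∈ Set.Ioo (0 : ℝ) 1, ∀ γ ∈ Set.Ioo γbar 1, ∀ᵐ ω ∂P, ∀ᶠ j : ℕ in atTop,
        ‖stoppedValue (Kaczmarz.iterate A b x₀ w) (τ j) ω
            - EuclideanGeometry.orthogonalProjection (Kaczmarz.solutionSpace A b) x₀‖ ^ 2
          ≤ γ ^ j * ‖x₀
            - EuclideanGeometry.orthogonalProjection (Kaczmarz.solutionSpace A b) x₀‖ ^ 2) := by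
  by_cases hx₀ : x₀ ∈ Kaczmarz.solutionSpace A b
  · exact Or.inl ⟨fun _ => 0, isStoppingTime_const _ 0, by simp,
      Eventually.of_forall fun _ => hx₀⟩
  right
  set p : EuclideanSpace ℝ (Fin d) :=
    (EuclideanGeometry.orthogonalProjection (Kaczmarz.solutionSpace A b) x₀).1
  have hpmem : p ∈ Kaczmarz.solutionSpace A b :=
    EuclideanGeometry.orthogonalProjection_mem x₀
  have hp : A.toEuclideanLin p = b := hpmem
  have h₀ : x₀ - p ∈ (LinearMap.ker A.toEuclideanLin)ᗮ := by
    rw [← Kaczmarz.direction_solutionSpace A b]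
    exact EuclideanGeometry.vsub_orthogonalProjection_mem_direction_orthogonal _ x₀
  have hR : 0 < ‖x₀ - p‖ ^ 2 := by
    have : x₀ - p ≠ 0 := fun h => hx₀ (sub_eq_zero.1 h ▸ hpmem)
    positivity
  have hr := Kaczmarz.one_le_rank_of_notMem_solutionSpace A b hx₀
  obtain ⟨c, hc01, hc⟩ := Kaczmarz.exists_integral_gain_ge A
  refine ⟨fun j _ => ((j * A.rank : ℕ) : WithTop ℕ), fun j => isStoppingTime_const _ _,
    fun j => ?_, 1 - c, ⟨sub_pos.2 hc01.2, sub_lt_self 1 hc01.1⟩, fun γ hγ => ?_⟩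
  · rw [lintegral_const, measure_univ, mul_one]
    change ((j * A.rank : ℕ) : ℕ∞).toENNReal ≤ _
    simp
  · refine Kaczmarz.ae_eventually_le_of_lintegral_le
      (f := fun j ω => ‖Kaczmarz.iterate A b x₀ w (j * A.rank) ω - p‖ ^ 2)
      (fun j => ((Kaczmarz.measurable_iterate A b x₀ hw _).sub_const p).norm.pow_const 2)
      (sub_pos.2 hc01.2).le hγ.1 hR fun j => ?_
    refine (Kaczmarz.lintegral_norm_iterate_sub_sq_le A b x₀ hw hlaw hindep hc01.2.le hc hp h₀
      (j * A.rank)).trans (ENNReal.ofReal_le_ofReal ?_)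
    -- Since `rank A ≥ 1`, running `j * rank A ≥ j` steps gives at least `j` contractions.
    exact mul_le_mul_of_nonneg_right (pow_le_pow_of_le_one (sub_pos.2 hc01.2).le
      (sub_lt_self 1 hc01.1).le (Nat.le_mul_of_pos_right j hr)) hR.le
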